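/- For a positive integer $n$ put $a_k(n)=n^k/k!$, $S_0(n)=\sum_{k=0}^{n-1} n^k/k!$, $p_k(n)=\dfrac{n!\,k}{(n-k)!\,n^{k+1}}$ for $1\le k\le n$, and $R_1(n)=\sum_{k=1}^n p_k(n)\,k$. Let $\tau(n)$ be the real number determined by Stirling's formula $n!=(n/e)^n\sqrt{2\pi n}\,e^{\tau(n)}$, and let $\sigma(n)$ be the real number determined by $\dfrac{e^n}{2}=S_0(n)+\left(\dfrac13+\sigma(n)\right)\dfrac{n^n}{n!}$. Then for every positive integer $n$ $$R_1(n)=\frac{n!}{n^n}S_0(n)=\sqrt{\frac{\pi n}{2}}-\frac13+\kappa(n),$$ where $$\kappa(n)=\sqrt{\frac{\pi n}{2}}\left(e^{\tau(n)}-1-\frac{2\sigma(n)e^{\tau(n)}}{e^n}\cdot\frac{n^n}{n!}\right),$$ which equals $\sqrt{\pi n/2}\,\bigl(e^{\tau(n)}-1\bigr)-\sigma(n)$. Moreover $\kappa$ is strictly decreasing, $\kappa(n+1)<\kappa(n)$ for all $n\ge 1$, and $\kappa(n)\to0$ as $n\to\infty$. -/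

import Mathlib

open Filter Topology
open scoped Nat

namespace RamanujanQ

noncomputable section

/-- `a_k(n) = n^k / k!`. -/
def a (n k : ℕ) : ℝ := (n : ℝ) ^ k / (k ! : ℝ)

/-- `S_i(n) = ∑_{k=0}^{n-1} a_k(n) k^i` (with `0^0 = 1`, so that `S_0(n) = ∑_{k<n} n^k / k!`). -/
def S (i n : ℕ) : ℝ := ∑ k ∈ Finset.range n, a n k * (k : ℝ) ^ i

/-- The probability `p_k(n) = n! k / ((n - k)! n^(k+1))`, used for `1 ≤ k ≤ n` only. -/
def p (n k : ℕ) : ℝ := (n ! : ℝ) * k / (((n - k) ! : ℝ) * (n : ℝ) ^ (k + 1))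

/-- `R_i(n) = ∑_{k=1}^{n} p_k(n) k^i`. -/
def R (i n : ℕ) : ℝ := ∑ k ∈ Finset.Icc 1 n, p n k * (k : ℝ) ^ i

/-- The error exponent `τ(n)` in Stirling's formula `n! = (n/e)^n √(2πn) e^{τ(n)}`;
it is the unique real number with this property, see `stirling_tau`. -/
def τ (n : ℕ) : ℝ :=
  Real.log ((n ! : ℝ) / (((n : ℝ) / Real.exp 1) ^ n * √(2 * Real.pi * n)))

/-- Szegő's `σ(n)`, the unique solution of `e^n / 2 = S_0(n) + (1/3 + σ(n)) a_n(n)`,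
see `szego_sigma`. -/
def σ (n : ℕ) : ℝ := (Real.exp n / 2 - S 0 n) / a n n - 1 / 3

/-- `κ(n) = √(πn/2) (e^τ - 1 - 2 σ e^τ a_n / e^n)`. -/
def κ (n : ℕ) : ℝ :=
  √(Real.pi * n / 2) *
    (Real.exp (τ n) - 1 - 2 * σ n * Real.exp (τ n) * a n n / Real.exp n)

theorem stirling_tau (n : ℕ) (hn : 1 ≤ n) :
    (n ! : ℝ) = ((n : ℝ) / Real.exp 1) ^ n * √(2 * Real.pi * n) * Real.exp (τ n) := by
  have hn' : (0 : ℝ) < n := by exact_mod_cast hn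
  have hf : (0 : ℝ) < (n ! : ℝ) := by exact_mod_cast Nat.factorial_pos n
  have hd : 0 < ((n : ℝ) / Real.exp 1) ^ n * √(2 * Real.pi * n) := by positivity
  rw [τ, Real.exp_log (div_pos hf hd), mul_div_cancel₀ _ hd.ne']

theorem szego_sigma (n : ℕ) (hn : 1 ≤ n) :
    Real.exp n / 2 = S 0 n + (1 / 3 + σ n) * a n n := by
  have hn' : (0 : ℝ) < n := by exact_mod_cast hn
  have ha : a n n ≠ 0 := by unfold a; positivity
  unfold σ
  field_simp
  ring

end

end RamanujanQ

/-! The identities for `R 1 n` are finite algebra. For the behaviour of `κ`, expanding the binomial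
gives R_1(n) = ∫_0^∞ e^{-x}(1+x/n)^{n-1} dx, and s = n h(x/n) turns this into ∫ e^{-s}/t(s/n) ds
with t = h⁻¹. Since √(πn/2) = ∫ e^{-s}/√(2s/n) ds and 1/3 = ∫ e^{-s}/3 ds, one gets κ(n) = ∫ e^{-s}
ψ(t(s/n)) ds (`kappa_eq_integral`). As ψ is strictly increasing (`strictMonoOn_recipGap`), takes
values in [0, 1/3] and tends to 0 at 0, κ strictly decreases and dominated convergence gives the
limit. -/

namespace RamanujanQ

/-! ### The function h and its inverse -/

/-- `h(t) = t - log (1 + t)`. -/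
noncomputable def logGap (t : ℝ) : ℝ := t - Real.log (1 + t)

/-- `ψ(t) = 1/t - 1/√(2 h(t)) + 1/3`. -/
noncomputable def recipGap (t : ℝ) : ℝ := 1 / t - 1 / √(2 * logGap t) + 1 / 3

theorem hasDerivAt_logGap {t : ℝ} (ht : -1 < t) : HasDerivAt logGap (t / (1 + t)) t := by
  have h1 : (1 + t) ≠ 0 := by linarith
  have := (hasDerivAt_id t).sub (((hasDerivAt_id t).const_add 1).log h1)
  refine this.congr_deriv ?_
  simp only [id]
  field_simp
  ring

theorem continuousOn_logGap : ContinuousOn logGap (Set.Ici 0) := fun t ht =>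
  (hasDerivAt_logGap (by linarith [Set.mem_Ici.1 ht])).continuousAt.continuousWithinAt

theorem logGap_zero : logGap 0 = 0 := by simp [logGap]

theorem strictMonoOn_logGap : StrictMonoOn logGap (Set.Ici 0) := by
  refine strictMonoOn_of_deriv_pos (convex_Ici 0) continuousOn_logGap fun t ht => ?_
  rw [interior_Ici, Set.mem_Ioi] at ht
  rw [(hasDerivAt_logGap (by linarith)).deriv]
  positivity

theorem logGap_pos {t : ℝ} (ht : 0 < t) : 0 < logGap t := by
  simpa [logGap_zero] using strictMonoOn_logGap Set.self_mem_Ici ht.le ht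

theorem exists_logGap_eq {y : ℝ} (hy : 0 < y) : ∃ t, 0 < t ∧ logGap t = y := by
  -- The tangent to log at 2 has slope 1/2, so h grows at least like t/2 up to a constant.
  have hbig : y ≤ logGap (2 * y + 4) := by
    have h1 := Real.log_le_sub_one_of_pos (x := (1 + (2 * y + 4)) / 2) (by linarith)
    rw [Real.log_div (by linarith) (by norm_num)] at h1
    have h2 := Real.log_two_lt_d9
    unfold logGap
    linarith
  obtain ⟨t, ht, rfl⟩ := intermediate_value_Icc (a := 0) (b := 2 * y + 4) (by linarith)
    (continuousOn_logGap.mono Set.Icc_subset_Ici_self)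
    ⟨by rw [logGap_zero]; exact hy.le, hbig⟩
  refine ⟨t, lt_of_le_of_ne ht.1 ?_, rfl⟩
  rintro rfl
  exact hy.ne' logGap_zero

theorem bijOn_logGap : Set.BijOn logGap (Set.Ioi 0) (Set.Ioi 0) :=
  ⟨fun _ ht => logGap_pos ht,
    (strictMonoOn_logGap.mono Set.Ioi_subset_Ici_self).injOn,
    fun _ hy => exists_logGap_eq hy⟩

/-- The inverse of `logGap` on the positive half-line. -/
noncomputable def logGapInv : ℝ → ℝ := Function.invFunOn logGap (Set.Ioi 0)

theorem logGapInv_pos {y : ℝ} (hy : 0 < y) : 0 < logGapInv y :=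
  Function.invFunOn_mem (bijOn_logGap.surjOn hy)

theorem logGap_logGapInv {y : ℝ} (hy : 0 < y) : logGap (logGapInv y) = y :=
  Function.invFunOn_eq (bijOn_logGap.surjOn hy)

theorem logGapInv_logGap {t : ℝ} (ht : 0 < t) : logGapInv (logGap t) = t :=
  bijOn_logGap.injOn (logGapInv_pos (logGap_pos ht)) ht (logGap_logGapInv (logGap_pos ht))

theorem strictMonoOn_logGapInv : StrictMonoOn logGapInv (Set.Ioi 0) := by
  intro x hx y hy hxy
  rw [← logGap_logGapInv hx, ← logGap_logGapInv hy] at hxy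
  exact (strictMonoOn_logGap.lt_iff_lt (logGapInv_pos hx).le (logGapInv_pos hy).le).1 hxy

theorem logGapInv_le {y c : ℝ} (hc : 0 < c) (hy : 0 < y) (h : y ≤ logGap c) :
    logGapInv y ≤ c := by
  rw [← logGapInv_logGap hc]
  exact strictMonoOn_logGapInv.monotoneOn hy (logGap_pos hc) h

theorem tendsto_logGapInv : Tendsto logGapInv (𝓝[>] 0) (𝓝[>] 0) := by
  refine tendsto_nhdsWithin_iff.2 ⟨?_, eventually_mem_nhdsWithin.mono fun y hy => logGapInv_pos hy⟩
  rw [Metric.tendsto_nhds]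
  intro ε hε
  have hc : 0 < ε / 2 := by positivity
  filter_upwards [Ioo_mem_nhdsGT (logGap_pos hc)] with y hy
  have h1 := logGapInv_le hc hy.1 hy.2.le
  rw [Real.dist_eq, sub_zero, abs_of_pos (logGapInv_pos hy.1)]
  linarith

/-! ### Monotonicity and bounds for ψ -/

theorem exists_cube_eq {t : ℝ} (ht : 0 < t) : ∃ w : ℝ, 1 < w ∧ w ^ 3 = 1 + t := by
  refine ⟨(1 + t) ^ (1 / 3 : ℝ), Real.one_lt_rpow (by linarith) (by norm_num), ?_⟩
  rw [← Real.rpow_natCast, ← Real.rpow_mul (by linarith)]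
  norm_num

/-- Setting 1 + t = w³ removes the cube root; the difference of the sides vanishes at w = 1 and its
derivative carries the factor (w - 1)³. -/
theorem two_mul_logGap_cube_lt {w : ℝ} (hw : 1 < w) :
    2 * logGap (w ^ 3 - 1) < ((w ^ 3 - 1) / w) ^ 2 := by
  let F : ℝ → ℝ := fun w => (w ^ 2 - 1 / w) ^ 2 - 2 * (w ^ 3 - 1 - 3 * Real.log w)
  have hd : ∀ x : ℝ, 0 < x →
      HasDerivAt F (2 * (x - 1) ^ 3 * (2 * x ^ 3 + 3 * x ^ 2 + 3 * x + 1) / x ^ 3) x := by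
    intro x hx
    have h1 : HasDerivAt (fun w : ℝ => w ^ 2 - 1 / w) (2 * x + 1 / x ^ 2) x := by
      have := (hasDerivAt_pow 2 x).sub (hasDerivAt_inv hx.ne')
      simp only [one_div]
      refine this.congr_deriv ?_
      simp
    have h2 : HasDerivAt (fun w : ℝ => w ^ 3 - 1 - 3 * Real.log w) (3 * x ^ 2 - 3 * x⁻¹) x := by
      have := ((hasDerivAt_pow 3 x).sub_const 1).sub ((Real.hasDerivAt_log hx.ne').const_mul 3)
      refine this.congr_deriv ?_
      simp
    refine ((h1.pow 2).sub (h2.const_mul 2)).congr_deriv ?_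
    norm_num only [pow_one, Nat.cast_ofNat]
    field_simp
    ring
  have hm : StrictMonoOn F (Set.Ici 1) := by
    refine strictMonoOn_of_deriv_pos (convex_Ici 1) (fun x hx =>
      (hd x (by linarith [Set.mem_Ici.1 hx])).continuousAt.continuousWithinAt) fun x hx => ?_
    rw [interior_Ici, Set.mem_Ioi] at hx
    rw [(hd x (by linarith)).deriv]
    have : 0 < x - 1 := by linarith
    positivity
  have := hm Set.self_mem_Ici hw.le hw
  simp only [F] at this
  norm_num at this
  have h3 : (w ^ 3 - 1) / w = w ^ 2 - w⁻¹ := by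
    have : w ≠ 0 := by linarith
    field_simp
  rw [logGap, h3, add_sub_cancel, Real.log_pow]
  push_cast
  linarith

theorem sqrt_logGap_mul_lt {t w : ℝ} (ht : 0 < t) (hw : 1 < w) (h : w ^ 3 = 1 + t) :
    √(2 * logGap t) * w < t := by
  have ht' : t = w ^ 3 - 1 := by linarith
  have hw0 : 0 < w := by linarith
  rw [← lt_div_iff₀ hw0, Real.sqrt_lt' (by positivity), ht']
  exact two_mul_logGap_cube_lt hw

theorem sqrt_logGap_pos {t : ℝ} (ht : 0 < t) : 0 < √(2 * logGap t) :=
  Real.sqrt_pos.2 (by linarith [logGap_pos ht])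

/-- With u = √(2h), ψ' > 0 amounts to (1 + t)u³ < t³, the cube of `sqrt_logGap_mul_lt`. -/
theorem strictMonoOn_recipGap : StrictMonoOn recipGap (Set.Ioi 0) := by
  have hd : ∀ t : ℝ, 0 < t → HasDerivAt recipGap
      (-1 / t ^ 2 + t / ((1 + t) * √(2 * logGap t) ^ 3)) t := by
    intro t ht
    have hu := sqrt_logGap_pos ht
    have h1 := (hasDerivAt_inv ht.ne').sub
      ((((hasDerivAt_logGap (by linarith : -1 < t)).const_mul 2).sqrt
        (by linarith [logGap_pos ht] : 2 * logGap t ≠ 0)).inv hu.ne')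
    have h2 := h1.add_const (1 / 3)
    have h3 : recipGap = fun t => t⁻¹ - (√(2 * logGap t))⁻¹ + 1 / 3 := by
      funext t; simp [recipGap]
    rw [h3]
    refine h2.congr_deriv ?_
    field_simp
    ring
  refine strictMonoOn_of_deriv_pos (convex_Ioi 0) (fun x hx =>
      (hd x hx).continuousAt.continuousWithinAt) fun t ht => ?_
  rw [interior_Ioi, Set.mem_Ioi] at ht
  rw [(hd t ht).deriv]
  obtain ⟨w, hw, h⟩ := exists_cube_eq ht
  have hu := sqrt_logGap_pos ht
  have hlt := sqrt_logGap_mul_lt ht hw h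
  have h3 : (√(2 * logGap t) * w) ^ 3 < t ^ 3 := by gcongr
  have h4 : (1 + t) * √(2 * logGap t) ^ 3 < t ^ 3 := by rw [← h]; linarith [mul_pow (√(2 * logGap t)) w 3]
  have h5 : 1 / t ^ 2 < t / ((1 + t) * √(2 * logGap t) ^ 3) := by
    rw [div_lt_div_iff₀ (by positivity) (by positivity)]
    linarith
  have h6 : -1 / t ^ 2 = -(1 / t ^ 2) := by ring
  linarith

/-- The reciprocal of 3t/(3+t) is 1/t + 1/3, so this is ψ ≥ 0 in disguise. -/
theorem le_two_mul_logGap {t : ℝ} (ht : 0 ≤ t) : (3 * t / (3 + t)) ^ 2 ≤ 2 * logGap t := by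
  let F : ℝ → ℝ := fun t => 2 * logGap t - (3 * t / (3 + t)) ^ 2
  have hd : ∀ x : ℝ, 0 ≤ x → HasDerivAt F (2 * x ^ 3 * (9 + x) / ((1 + x) * (3 + x) ^ 3)) x := by
    intro x hx
    have h3 : 3 + x ≠ 0 := by positivity
    have h1 : HasDerivAt (fun t : ℝ => 3 * t / (3 + t)) (9 / (3 + x) ^ 2) x := by
      refine (((hasDerivAt_id x).const_mul 3).div ((hasDerivAt_id x).const_add 3) h3).congr_deriv ?_
      simp only [id]
      field_simp
      ring
    refine (((hasDerivAt_logGap (by linarith)).const_mul 2).sub (h1.pow 2)).congr_deriv ?_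
    have h4 : 1 + x ≠ 0 := by positivity
    norm_num only [pow_one, Nat.cast_ofNat]
    field_simp
    ring
  have hm : MonotoneOn F (Set.Ici 0) := by
    refine monotoneOn_of_deriv_nonneg (convex_Ici 0) (fun x hx =>
      (hd x hx).continuousAt.continuousWithinAt) (fun x hx => ?_) fun x hx => ?_
    · rw [interior_Ici] at hx
      exact (hd x (le_of_lt hx)).differentiableAt.differentiableWithinAt
    · rw [interior_Ici, Set.mem_Ioi] at hx
      rw [(hd x hx.le).deriv]
      positivity
  have := hm Set.self_mem_Ici ht ht
  simp only [F, logGap_zero] at this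
  norm_num at this
  linarith

theorem recipGap_nonneg {t : ℝ} (ht : 0 < t) : 0 ≤ recipGap t := by
  have h1 : 3 * t / (3 + t) ≤ √(2 * logGap t) := Real.le_sqrt_of_sq_le (le_two_mul_logGap ht.le)
  have h2 : 1 / √(2 * logGap t) ≤ 1 / (3 * t / (3 + t)) :=
    one_div_le_one_div_of_le (by positivity) h1
  have h3 : 1 / (3 * t / (3 + t)) = 1 / t + 1 / 3 := by field_simp
  unfold recipGap
  linarith

theorem recipGap_le {t w : ℝ} (ht : 0 < t) (hw : 1 < w) (h : w ^ 3 = 1 + t) :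
    recipGap t ≤ 1 / 3 - (w - 1) / t := by
  have hu := sqrt_logGap_pos ht
  have h1 : w / t ≤ 1 / √(2 * logGap t) := by
    rw [div_le_div_iff₀ ht hu]
    linarith [sqrt_logGap_mul_lt ht hw h]
  unfold recipGap
  rw [sub_div]
  linarith

theorem recipGap_le_third {t : ℝ} (ht : 0 < t) : recipGap t ≤ 1 / 3 := by
  obtain ⟨w, hw, h⟩ := exists_cube_eq ht
  have := recipGap_le ht hw h
  have : 0 < (w - 1) / t := div_pos (by linarith) ht
  linarith

theorem recipGap_le_self {t : ℝ} (ht : 0 < t) : recipGap t ≤ t := by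
  obtain ⟨w, hw, h⟩ := exists_cube_eq ht
  have h1 := recipGap_le ht hw h
  -- With w = 1 + d, this reduces to t/3 - d = d² + d³/3 ≤ t².
  have h2 : 1 / 3 - t ≤ (w - 1) / t := by
    rw [le_div_iff₀ ht]
    have ht' : t = w ^ 3 - 1 := by linarith
    obtain ⟨d, rfl⟩ : ∃ d, w = 1 + d := ⟨w - 1, by ring⟩
    have hd : 0 < d := by linarith
    have : t = d * (3 + 3 * d + d ^ 2) := by rw [ht']; ring
    have h9 : 3 * d ≤ t := by nlinarith [pow_pos hd 3, pow_pos hd 2]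
    have h8 : t ^ 2 ≥ (d * (3 + 3 * d + d ^ 2)) * (3 * d) := by nlinarith
    nlinarith [pow_pos hd 3, pow_pos hd 2, pow_pos hd 4]
  linarith

theorem tendsto_recipGap : Tendsto recipGap (𝓝[>] 0) (𝓝 0) := by
  refine tendsto_of_tendsto_of_tendsto_of_le_of_le' tendsto_const_nhds
    (tendsto_nhdsWithin_of_tendsto_nhds tendsto_id) ?_ ?_
  · exact eventually_mem_nhdsWithin.mono fun t ht => recipGap_nonneg ht
  · exact eventually_mem_nhdsWithin.mono fun t ht => recipGap_le_self ht

/-! ### Finite sums and the algebraic identities -/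

theorem cast_descFactorial_succ (n k : ℕ) :
    (n.descFactorial (k + 1) : ℝ) = (n - k) * n.descFactorial k := by
  rcases le_or_gt k n with h | h
  · rw [Nat.descFactorial_succ, Nat.cast_mul, Nat.cast_sub h]
  · simp [Nat.descFactorial_of_lt h]

theorem p_mul_eq {n k : ℕ} (hk : k ≤ n) :
    p n k * (k : ℝ) ^ 1 = k ^ 2 * (n.descFactorial k / (n : ℝ) ^ (k + 1)) := by
  have h : (n ! : ℝ) = (n - k) ! * n.descFactorial k := by
    exact_mod_cast (Nat.factorial_mul_descFactorial hk).symm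
  have h2 : ((n - k) ! : ℝ) ≠ 0 := by positivity
  rw [p, h]
  field_simp

/-- Summation by parts: with D_k = n(n-1)⋯(n-k+1), k D_k/n^{k+1} = D_k/n^k - D_{k+1}/n^{k+1}. The
boundary term vanishes at N = n. -/
theorem sum_sq_mul_descFactorial_div {n : ℕ} (hn : 1 ≤ n) (N : ℕ) :
    ∑ k ∈ Finset.Icc 1 N, (k : ℝ) ^ 2 * (n.descFactorial k / (n : ℝ) ^ (k + 1)) =
      ∑ j ∈ Finset.range N, n.descFactorial (j + 1) / (n : ℝ) ^ (j + 1) -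
        N * (n.descFactorial (N + 1) / (n : ℝ) ^ (N + 1)) := by
  have hn' : (n : ℝ) ≠ 0 := by positivity
  induction N with
  | zero => simp
  | succ N ih =>
    rw [Finset.sum_Icc_succ_top (by omega), ih, Finset.sum_range_succ,
      cast_descFactorial_succ n (N + 1)]
    push_cast
    field_simp
    ring

theorem factorial_div_mul_S {n : ℕ} (hn : 1 ≤ n) :
    (n ! : ℝ) / (n : ℝ) ^ n * S 0 n =
      ∑ j ∈ Finset.range n, n.descFactorial (j + 1) / (n : ℝ) ^ (j + 1) := by
  have hn' : (n : ℝ) ≠ 0 := by positivity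
  rw [S, Finset.mul_sum, ← Finset.sum_range_reflect]
  refine Finset.sum_congr rfl fun j hj => ?_
  rw [Finset.mem_range] at hj
  have e : n - 1 - j = n - (j + 1) := by omega
  have h : (n ! : ℝ) = (n - (j + 1)) ! * n.descFactorial (j + 1) := by
    exact_mod_cast (Nat.factorial_mul_descFactorial (show j + 1 ≤ n by omega)).symm
  have h2 : ((n - (j + 1)) ! : ℝ) ≠ 0 := by positivity
  have h3 : (n : ℝ) ^ n = (n : ℝ) ^ (n - (j + 1)) * (n : ℝ) ^ (j + 1) := by
    rw [← pow_add]; congr 1; omega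
  rw [a, e, h, h3]
  field_simp

theorem R_one_eq {n : ℕ} (hn : 1 ≤ n) : R 1 n = (n ! : ℝ) / (n : ℝ) ^ n * S 0 n := by
  rw [R, Finset.sum_congr rfl fun k hk => p_mul_eq (Finset.mem_Icc.1 hk).2,
    sum_sq_mul_descFactorial_div hn, factorial_div_mul_S hn,
    Nat.descFactorial_of_lt (Nat.lt_succ_self n)]
  simp

theorem factorial_div_pow_mul_exp {n : ℕ} (hn : 1 ≤ n) :
    (n ! : ℝ) / (n : ℝ) ^ n * Real.exp n = 2 * √(Real.pi * n / 2) * Real.exp (τ n) := by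
  have hn' : (0 : ℝ) < n := by positivity
  have h1 : √(2 * Real.pi * n) = 2 * √(Real.pi * n / 2) := by
    rw [show 2 * Real.pi * n = 2 ^ 2 * (Real.pi * n / 2) by ring,
      Real.sqrt_mul (by positivity), Real.sqrt_sq (by norm_num)]
  rw [stirling_tau n hn, h1, div_pow, Real.exp_one_pow]
  field_simp

theorem kappa_eq {n : ℕ} (hn : 1 ≤ n) :
    κ n = √(Real.pi * n / 2) * (Real.exp (τ n) - 1) - σ n := by
  have hn' : (0 : ℝ) < n := by positivity
  have h := factorial_div_pow_mul_exp hn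
  have h1 : 2 * √(Real.pi * n / 2) * Real.exp (τ n) * (a n n / Real.exp n) = 1 := by
    rw [← h, a]
    field_simp
  rw [κ]
  linear_combination (-σ n) * h1

theorem R_one_eq_add_kappa {n : ℕ} (hn : 1 ≤ n) :
    R 1 n = √(Real.pi * n / 2) - 1 / 3 + κ n := by
  have hn' : (0 : ℝ) < n := by positivity
  have h1 := szego_sigma n hn
  have h2 := factorial_div_pow_mul_exp hn
  have h3 : (n ! : ℝ) / (n : ℝ) ^ n * a n n = 1 := by
    rw [a]
    field_simp
  rw [R_one_eq hn, kappa_eq hn]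
  linear_combination (-(n ! : ℝ) / (n : ℝ) ^ n) * h1 + h2 / 2 - (1 / 3 + σ n) * h3

/-! ### Integral representations -/

open MeasureTheory

theorem integrableOn_exp_neg_mul_pow (j : ℕ) :
    IntegrableOn (fun x : ℝ => Real.exp (-x) * x ^ j) (Set.Ioi 0) := by
  have := Real.GammaIntegral_convergent (s := j + 1) (by positivity)
  simpa using this

theorem integral_exp_neg_mul_pow (j : ℕ) :
    ∫ x in Set.Ioi (0 : ℝ), Real.exp (-x) * x ^ j = j ! := by
  have := Real.Gamma_eq_integral (s := j + 1) (by positivity)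
  rw [Real.Gamma_nat_eq_factorial] at this
  simpa using this.symm

theorem exp_neg_mul_one_add_div_pow_eq (n : ℕ) (x : ℝ) :
    Real.exp (-x) * (1 + x / n) ^ (n - 1) =
      ∑ j ∈ Finset.range (n - 1 + 1),
        ((n - 1).choose j / (n : ℝ) ^ j) * (Real.exp (-x) * x ^ j) := by
  rw [add_comm 1, add_pow, Finset.mul_sum]
  refine Finset.sum_congr rfl fun j _ => ?_
  rw [one_pow, div_pow]
  ring

theorem integrableOn_exp_neg_mul_one_add_div_pow (n : ℕ) :
    IntegrableOn (fun x : ℝ => Real.exp (-x) * (1 + x / n) ^ (n - 1)) (Set.Ioi 0) := by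
  simp only [exp_neg_mul_one_add_div_pow_eq]
  exact integrable_finsetSum _ fun j _ => (integrableOn_exp_neg_mul_pow j).const_mul _

theorem integral_exp_neg_mul_one_add_div_pow {n : ℕ} (hn : 1 ≤ n) :
    ∫ x in Set.Ioi (0 : ℝ), Real.exp (-x) * (1 + x / n) ^ (n - 1) = R 1 n := by
  simp only [exp_neg_mul_one_add_div_pow_eq]
  rw [integral_finsetSum _ fun j _ => (integrableOn_exp_neg_mul_pow j).const_mul _,
    R_one_eq hn, factorial_div_mul_S hn, Nat.sub_add_cancel hn]
  refine Finset.sum_congr rfl fun j _ => ?_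
  have hn' : (n : ℝ) ≠ 0 := by positivity
  have h : (n.descFactorial (j + 1) : ℝ) = n * (j ! * (n - 1).choose j) := by
    obtain ⟨m, rfl⟩ : ∃ m, n = m + 1 := ⟨n - 1, by omega⟩
    rw [Nat.succ_descFactorial_succ, Nat.descFactorial_eq_factorial_mul_choose]
    push_cast
    simp
  rw [integral_const_mul, integral_exp_neg_mul_pow, h]
  field_simp
  ring

/-- The substitution `s = n h(x / n)`. -/
theorem scaled_logGap_subst {n : ℕ} (hn : 1 ≤ n) :
    IntegrableOn (fun s : ℝ => Real.exp (-s) * (1 / logGapInv (s / n))) (Set.Ioi 0) ∧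
      ∫ s in Set.Ioi (0 : ℝ), Real.exp (-s) * (1 / logGapInv (s / n)) = R 1 n := by
  have hn' : (0 : ℝ) < n := by positivity
  let f : ℝ → ℝ := fun x => n * logGap (x / n)
  let f' : ℝ → ℝ := fun x => x / n / (1 + x / n)
  have hf : ∀ x ∈ Set.Ioi (0 : ℝ), HasDerivWithinAt f (f' x) (Set.Ioi 0) x := by
    intro x hx
    have hx' : 0 < x / n := div_pos hx hn'
    have h1 : HasDerivAt (fun x : ℝ => x / n) (1 / n) x := (hasDerivAt_id x).div_const _
    have h2 : HasDerivAt (fun x : ℝ => n * logGap (x / n)) (n * (x / n / (1 + x / n) * (1 / n))) x :=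
      ((hasDerivAt_logGap (by linarith : -1 < x / n)).comp x h1).const_mul _
    refine (h2.congr_deriv ?_).hasDerivWithinAt
    simp only [f']
    field_simp
  have hinj : Set.InjOn f (Set.Ioi 0) := by
    intro x hx y hy hxy
    have h1 : logGap (x / n) = logGap (y / n) := mul_left_cancel₀ hn'.ne' hxy
    have h2 := bijOn_logGap.injOn (Set.mem_Ioi.2 (div_pos hx hn')) (Set.mem_Ioi.2 (div_pos hy hn')) h1
    field_simp at h2
    exact h2
  have himg : f '' Set.Ioi 0 = Set.Ioi 0 := by
    ext y
    constructor
    · rintro ⟨x, hx, rfl⟩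
      exact mul_pos hn' (logGap_pos (div_pos hx hn'))
    · intro hy
      obtain ⟨t, ht, h⟩ := exists_logGap_eq (div_pos (Set.mem_Ioi.1 hy) hn')
      refine ⟨n * t, mul_pos hn' ht, ?_⟩
      simp only [f]
      rw [mul_div_cancel_left₀ _ hn'.ne', h]
      field_simp
  have hcongr : Set.EqOn
      (fun x => |f' x| • (fun s : ℝ => Real.exp (-s) * (1 / logGapInv (s / n))) (f x))
      (fun x : ℝ => Real.exp (-x) * (1 + x / n) ^ (n - 1)) (Set.Ioi 0) := by
    intro x hx
    have hx0 : 0 < x := hx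
    have hx' : 0 < x / n := div_pos hx hn'
    -- The Jacobian (x/n)/(1 + x/n) cancels 1/t = n/x and lowers this exponent to n - 1.
    have h1 : Real.exp (-f x) = Real.exp (-x) * (1 + x / n) ^ n := by
      have : -f x = -x + n * Real.log (1 + x / n) := by
        simp only [f, logGap]
        field_simp
        ring
      rw [this, Real.exp_add, Real.exp_nat_mul, Real.exp_log (by linarith)]
    have h2 : logGapInv (f x / n) = x / n := by
      simp only [f]
      rw [mul_div_cancel_left₀ _ hn'.ne', logGapInv_logGap hx']
    have h3 : (1 + x / n) ^ n = (1 + x / n) ^ (n - 1) * (1 + x / n) := by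
      rw [← pow_succ, Nat.sub_add_cancel hn]
    have h4 : 0 ≤ f' x := by simp only [f']; positivity
    simp only [smul_eq_mul]
    rw [h1, h2, h3, abs_of_nonneg h4]
    simp only [f']
    have h5 : 1 + x / n ≠ 0 := by positivity
    generalize x / n = t at hx' h5 ⊢
    field_simp
  constructor
  · have := integrableOn_image_iff_integrableOn_abs_deriv_smul measurableSet_Ioi hf hinj
      (fun s : ℝ => Real.exp (-s) * (1 / logGapInv (s / n)))
    rw [himg] at this
    exact this.2 ((integrableOn_exp_neg_mul_one_add_div_pow n).congr_fun hcongr.symm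
      measurableSet_Ioi)
  · have := integral_image_eq_integral_abs_deriv_smul measurableSet_Ioi hf hinj
      (fun s : ℝ => Real.exp (-s) * (1 / logGapInv (s / n)))
    rw [himg] at this
    rw [this, setIntegral_congr_fun measurableSet_Ioi hcongr,
      integral_exp_neg_mul_one_add_div_pow hn]

/-- Exposes the Γ(1/2) integrand, whose integral is √π. -/
theorem exp_neg_mul_one_div_sqrt_eq (n : ℕ) {s : ℝ} (hs : 0 < s) :
    Real.exp (-s) * (1 / √(2 * (s / n))) =
      √(n / 2) * (Real.exp (-s) * s ^ ((1 / 2 : ℝ) - 1)) := by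
  have h1 : s ^ ((1 / 2 : ℝ) - 1) = 1 / √s := by
    rw [Real.sqrt_eq_rpow, one_div (s ^ _), ← Real.rpow_neg hs.le]
    norm_num
  have h2 : √(2 * (s / n)) = √s / √(n / 2) := by
    rw [← Real.sqrt_div hs.le]
    congr 1
    field_simp
  rw [h1, h2, one_div_div]
  ring

theorem integrableOn_exp_neg_mul_one_div_sqrt (n : ℕ) :
    IntegrableOn (fun s : ℝ => Real.exp (-s) * (1 / √(2 * (s / n)))) (Set.Ioi 0) :=
  IntegrableOn.congr_fun
    ((Real.GammaIntegral_convergent (s := 1 / 2) (by norm_num)).const_mul (√(n / 2)))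
    (fun _ hs => (exp_neg_mul_one_div_sqrt_eq n hs).symm) measurableSet_Ioi

theorem integral_exp_neg_mul_one_div_sqrt (n : ℕ) :
    ∫ s in Set.Ioi (0 : ℝ), Real.exp (-s) * (1 / √(2 * (s / n))) = √(Real.pi * n / 2) := by
  rw [setIntegral_congr_fun measurableSet_Ioi fun s hs => exp_neg_mul_one_div_sqrt_eq n hs,
    integral_const_mul, ← Real.Gamma_eq_integral (by norm_num), Real.Gamma_one_half_eq,
    ← Real.sqrt_mul (by positivity)]
  congr 1
  ring

theorem integrableOn_exp_neg_Ioi : IntegrableOn (fun s : ℝ => Real.exp (-s)) (Set.Ioi 0) := by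
  simpa using integrableOn_exp_neg_mul_pow 0

theorem exp_neg_mul_recipGap_eq {n : ℕ} (hn : 1 ≤ n) {s : ℝ} (hs : 0 < s) :
    Real.exp (-s) * recipGap (logGapInv (s / n)) =
      Real.exp (-s) * (1 / logGapInv (s / n)) - Real.exp (-s) * (1 / √(2 * (s / n))) +
        Real.exp (-s) * (1 / 3) := by
  have hn' : (0 : ℝ) < n := by positivity
  rw [recipGap, logGap_logGapInv (div_pos hs hn')]
  ring

theorem integrableOn_exp_neg_mul_recipGap {n : ℕ} (hn : 1 ≤ n) :
    IntegrableOn (fun s : ℝ => Real.exp (-s) * recipGap (logGapInv (s / n))) (Set.Ioi 0) :=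
  IntegrableOn.congr_fun
    (((scaled_logGap_subst hn).1.sub (integrableOn_exp_neg_mul_one_div_sqrt n)).add
      (integrableOn_exp_neg_Ioi.mul_const (1 / 3)))
    (fun _ hs => (exp_neg_mul_recipGap_eq hn hs).symm) measurableSet_Ioi

theorem kappa_eq_integral {n : ℕ} (hn : 1 ≤ n) :
    κ n = ∫ s in Set.Ioi (0 : ℝ), Real.exp (-s) * recipGap (logGapInv (s / n)) := by
  have h1 := (scaled_logGap_subst hn).1
  have h2 := integrableOn_exp_neg_mul_one_div_sqrt n
  rw [setIntegral_congr_fun measurableSet_Ioi fun s hs => exp_neg_mul_recipGap_eq hn hs,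
    integral_add (Integrable.sub' h1 h2) (integrableOn_exp_neg_Ioi.mul_const (1 / 3)),
    integral_sub h1 h2, (scaled_logGap_subst hn).2, integral_exp_neg_mul_one_div_sqrt,
    integral_mul_const, integral_exp_neg_Ioi_zero, R_one_eq_add_kappa hn]
  ring

/-! ### Monotonicity and limit of κ -/

theorem strictAntiOn_kappa : StrictAntiOn κ (Set.Ici 1) := by
  intro m hm n hn hmn
  have hm' : (0 : ℝ) < m := by exact_mod_cast (Set.mem_Ici.1 hm)
  have hmn' : (m : ℝ) < n := by exact_mod_cast hmn
  have hn' : (0 : ℝ) < n := hm'.trans hmn'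
  have im := integrableOn_exp_neg_mul_recipGap hm
  have in' := integrableOn_exp_neg_mul_recipGap hn
  have hlt : ∀ s ∈ Set.Ioi (0 : ℝ), 0 < Real.exp (-s) * recipGap (logGapInv (s / m)) -
      Real.exp (-s) * recipGap (logGapInv (s / n)) := by
    intro s hs
    have h1 : s / n < s / m := div_lt_div_of_pos_left hs hm' hmn'
    have h2 : 0 < s / n := div_pos hs hn'
    have h3 := strictMonoOn_logGapInv h2 (h2.trans h1) h1
    have h4 := strictMonoOn_recipGap (logGapInv_pos h2) (logGapInv_pos (h2.trans h1)) h3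
    have := mul_lt_mul_of_pos_left h4 (Real.exp_pos (-s))
    linarith
  rw [kappa_eq_integral hm, kappa_eq_integral hn, ← sub_pos, ← integral_sub im in',
    -- The integrand of the difference is positive on all of (0, ∞), so its support there has
    -- positive measure.
    setIntegral_pos_iff_support_of_nonneg_ae
      (ae_restrict_of_forall_mem measurableSet_Ioi fun s hs => (hlt s hs).le) (im.sub in'),
    Set.inter_eq_self_of_subset_right fun s hs => Function.mem_support.2 (hlt s hs).ne']
  simp

theorem tendsto_kappa : Tendsto κ atTop (𝓝 0) := by
  have h : Tendsto (fun n : ℕ => ∫ s in Set.Ioi (0 : ℝ),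
      Real.exp (-s) * recipGap (logGapInv (s / n))) atTop
        (𝓝 (∫ _ in Set.Ioi (0 : ℝ), (0 : ℝ))) := by
    refine tendsto_integral_filter_of_dominated_convergence (fun s => Real.exp (-s)) ?_ ?_
      integrableOn_exp_neg_Ioi ?_
    · filter_upwards [eventually_ge_atTop 1] with n hn
      exact (integrableOn_exp_neg_mul_recipGap hn).aestronglyMeasurable
    · filter_upwards [eventually_ge_atTop 1] with n hn
      refine ae_restrict_of_forall_mem measurableSet_Ioi fun s hs => ?_
      have ht : 0 < logGapInv (s / n) := logGapInv_pos (div_pos (Set.mem_Ioi.1 hs) (by positivity))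
      rw [norm_mul, Real.norm_of_nonneg (Real.exp_pos _).le, Real.norm_of_nonneg (recipGap_nonneg ht)]
      exact mul_le_of_le_one_right (Real.exp_pos _).le (by linarith [recipGap_le_third ht])
    · refine ae_restrict_of_forall_mem measurableSet_Ioi fun s hs => ?_
      have h1 : Tendsto (fun n : ℕ => s / (n : ℝ)) atTop (𝓝[>] 0) := by
        refine tendsto_nhdsWithin_iff.2 ⟨tendsto_const_div_atTop_nhds_zero_nat s, ?_⟩
        filter_upwards [eventually_ge_atTop 1] with n hn
        exact div_pos (Set.mem_Ioi.1 hs) (by positivity)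
      simpa using ((tendsto_recipGap.comp (tendsto_logGapInv.comp h1)).const_mul (Real.exp (-s)))
  rw [integral_zero] at h
  refine h.congr' ?_
  filter_upwards [eventually_ge_atTop 1] with n hn
  exact (kappa_eq_integral hn).symm

end RamanujanQ

theorem lemma7 :
    (∀ n : ℕ, 1 ≤ n →
      RamanujanQ.R 1 n = (n ! : ℝ) / (n : ℝ) ^ n * RamanujanQ.S 0 n ∧
      RamanujanQ.R 1 n = √(Real.pi * n / 2) - 1 / 3 + RamanujanQ.κ n) ∧
    StrictAntiOn RamanujanQ.κ (Set.Ici 1) ∧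
    Tendsto RamanujanQ.κ atTop (𝓝 0) :=
  ⟨fun _ hn => ⟨RamanujanQ.R_one_eq hn, RamanujanQ.R_one_eq_add_kappa hn⟩,
    RamanujanQ.strictAntiOn_kappa, RamanujanQ.tendsto_kappa⟩
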